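/- **Theorem 3.2.** Let $N\ge 1$ be an integer, $p\in\{0\}\cup[1,\infty]$, and let $X$ be a complex Banach space. Let $\mathbf X=l^p(\mathbb Z^N,X)$ be the Banach space of families $x=(x_i)_{i\in\mathbb Z^N}$ in $X$ with finite $p$-norm, where $l^0(\mathbb Z^N,X)$ denotes the closure in $l^\infty(\mathbb Z^N,X)$ of the set of finitely supported families. For bounded linear operators on $\mathbf X$, with the operator norm, we use the following notions. * For $\alpha\in\mathbb Z^N$, $V_\alpha$ is the shift $(V_\alpha x)_i=x_{i-\alpha}$; for $n\in\mathbb N$, $P_n$ is the operator of multiplication by the characteristic function of $\{-n,\dots,n\}^N$. * A *band operator* is a finite sum $\sum_\alpha a_\alpha V_\alpha$, where each $a_\alpha\in l^\infty(\mathbb Z^N,\mathcal L(X))$ acts by $(a_\alpha x)_i=a_\alpha(i)x_i$. A *band-dominated operator* is an operator in the norm closure of the set of band operators. * $K$ is *$\mathcal P$-compact* if $\|(I-P_n)K\|+\|K(I-P_n)\|\to0$ as $n\to\infty$; $\mathcal K(\mathbf X,\mathcal P)$ is the space of all $\mathcal P$-compact operators. The *$\mathcal P$-essential norm* of $A$ is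 the quotient norm $\|A+\mathcal K(\mathbf X,\mathcal P)\|=\inf\{\|A+K\|:K\in\mathcal K(\mathbf X,\mathcal P)\}$. * $A_n\to B$ *$\mathcal P$-strongly* if $\|K(A_n-B)\|+\|(A_n-B)K\|\to0$ for every $K\in\mathcal K(\mathbf X,\mathcal P)$. * If $h=(h_n)$ is a sequence in $\mathbb Z^N$ with $|h_n|\to\infty$, the *limit operator* $A_h$ is the $\mathcal P$-strong limit of $V_{-h_n}AV_{h_n}$, if it exists. The *operator spectrum* $\sigma_{\mathrm{op}}(A)$ is the set of all limit operators of $A$. The operator $A$ is *rich* if every sequence $h$ in $\mathbb Z^N$ with $|h_n|\to\infty$ has a subsequence $g$ for which $A_g$ exists. If $A$ is a rich band-dominated operator on $\mathbf X$, then $$\|A+\mathcal K(\mathbf X,\mathcal P)\|=\max_{A_g\in\sigma_{\mathrm{op}}(A)}\|A_g\|,$$ where the maximum exists, i.e. the supremum of $\|A_g\|$ over $\sigma_{\mathrm{op}}(A)$ is attained. -/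

import Mathlib

open Filter Topology
open scoped ENNReal

namespace LimitOps

noncomputable section

/-! ### The sequence spaces `l^p(ℤ^N, X)` for `p ∈ {0} ∪ [1, ∞]` -/

/-- The exponent of the ambient space of all `p`-summable (or bounded) sequences: it is `p` itself
for `p ∈ [1, ∞]`, while `l^0` is a subspace of `l^∞`. -/
def ambientExp (p : ℝ≥0∞) : ℝ≥0∞ := if p = 0 then ∞ else p

instance ambientExp_fact (p : ℝ≥0∞) [hp : Fact (p = 0 ∨ 1 ≤ p)] : Fact (1 ≤ ambientExp p) := by
  refine ⟨?_⟩
  unfold ambientExp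
  split_ifs with h
  · exact le_top
  · exact hp.out.resolve_left h

/-- The Banach space of all `X`-valued families on `ℤ^N` with finite `q`-norm. -/
abbrev Ambient (q : ℝ≥0∞) (N : ℕ) (X : Type*) [NormedAddCommGroup X] : Type _ :=
  lp (fun _ : Fin N → ℤ => X) q

section Ambient

variable (q : ℝ≥0∞) (N : ℕ) (X : Type*) [NormedAddCommGroup X] [NormedSpace ℂ X]

/-- The sequences with finite support. -/
def finSupp : Submodule ℂ (Ambient q N X) where
  carrier := {x | {i | x i ≠ 0}.Finite}
  add_mem' := by
    intro x y hx hy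
    refine (Set.Finite.union hx hy).subset fun i hi => ?_
    by_contra hcon
    have h1 : x i = 0 ∧ y i = 0 := by simpa [not_or] using hcon
    exact hi (by simp [h1.1, h1.2])
  zero_mem' := by simp
  smul_mem' := by
    intro c x hx
    refine Set.Finite.subset hx fun i hi => ?_
    intro h0
    exact hi (by simp [h0])

variable {q N X}

lemma memlp_shift {X : Type*} [NormedAddCommGroup X] (α : Fin N → ℤ) {x : (Fin N → ℤ) → X} (hx : Memℓp x q) :
    Memℓp (fun i => x (i - α)) q := by
  rcases q.trichotomy with (rfl | rfl | hq)
  · rw [memℓp_zero_iff] at hx ⊢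
    exact hx.preimage (f := fun i => i - α) (sub_left_injective.injOn)
  · rw [memℓp_infty_iff] at hx ⊢
    refine hx.mono ?_
    rintro _ ⟨i, rfl⟩
    exact ⟨i - α, rfl⟩
  · rw [memℓp_gen_iff hq] at hx ⊢
    exact (Equiv.subRight α).summable_iff.2 hx

/-- The shift `(x_i) ↦ (x_{i - α})` on the ambient space. -/
def ambientShift [Fact (1 ≤ q)] (α : Fin N → ℤ) : Ambient q N X →L[ℂ] Ambient q N X :=
  LinearMap.mkContinuous
    { toFun := fun x => ⟨fun i => x (i - α), memlp_shift α (lp.memℓp x)⟩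
      map_add' := fun _ _ => rfl
      map_smul' := fun _ _ => rfl } 1 (by
    intro x
    rw [one_mul]
    rcases q.trichotomy with (h | rfl | hq)
    · exact absurd (Fact.out : 1 ≤ q) (by simp [h])
    · exact lp.norm_le_of_forall_le (norm_nonneg _) fun i =>
        lp.norm_apply_le_norm (by simp) x (i - α)
    · refine lp.norm_le_of_tsum_le hq (norm_nonneg _) ?_
      rw [lp.norm_rpow_eq_tsum hq x]
      exact le_of_eq ((Equiv.subRight α).tsum_eq fun i => ‖x i‖ ^ q.toReal))

/-- Pointwise multiplication `(a x)_i = a_i x_i` by `a ∈ l^∞(ℤ^N, L(X))` on the ambient space. -/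
def ambientMul [Fact (1 ≤ q)] (a : lp (fun _ : Fin N → ℤ => X →L[ℂ] X) ∞) :
    Ambient q N X →L[ℂ] Ambient q N X :=
  lp.mapCLM q (fun i => a i) (norm_nonneg a) (fun i => lp.norm_apply_le_norm (by simp) a i)

end Ambient

section Spaces

variable (p : ℝ≥0∞) [Fact (p = 0 ∨ 1 ≤ p)] (N : ℕ)
  (X : Type*) [NormedAddCommGroup X] [NormedSpace ℂ X]

/-- `l^p(ℤ^N, X)`: all sequences with finite `p`-norm if `p ∈ [1, ∞]`; for `p = 0`, the closure in
`l^∞(ℤ^N, X)` of the finitely supported sequences. -/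
def seqSpace : Submodule ℂ (Ambient (ambientExp p) N X) :=
  if p = 0 then (finSupp (ambientExp p) N X).topologicalClosure else ⊤

/-- The Banach space `l^p(ℤ^N, X)`, with the usual `p`-norm (the supremum norm for `p = 0`). -/
def LpSeq : Type _ := ↥(seqSpace p N X)

instance : NormedAddCommGroup (LpSeq p N X) := inferInstanceAs (NormedAddCommGroup (seqSpace p N X))

instance : NormedSpace ℂ (LpSeq p N X) := inferInstanceAs (NormedSpace ℂ (seqSpace p N X))

/-- The entries `x_i` of a sequence `x ∈ l^p(ℤ^N, X)`. -/
instance : CoeFun (LpSeq p N X) (fun _ => (Fin N → ℤ) → X) := ⟨fun x => ⇑(Subtype.val x)⟩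

/-- The bounded linear operators on `l^p(ℤ^N, X)`, with the operator norm. -/
abbrev Op : Type _ := LpSeq p N X →L[ℂ] LpSeq p N X

variable {p N X}

lemma seqSpace_invariant
    (T : Ambient (ambientExp p) N X →L[ℂ] Ambient (ambientExp p) N X)
    (hT : ∀ x ∈ finSupp (ambientExp p) N X, T x ∈ finSupp (ambientExp p) N X) :
    ∀ x ∈ seqSpace p N X, T x ∈ seqSpace p N X := by
  intro x hx
  unfold seqSpace at hx ⊢
  split_ifs at hx ⊢ with h
  · exact map_mem_closure T.continuous hx hT
  · trivial

/-- The shift operator `V_α : (x_i) ↦ (x_{i - α})` on `l^p(ℤ^N, X)`. -/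
def shift (α : Fin N → ℤ) : Op p N X :=
  (ambientShift α).restrict (p := seqSpace p N X) (q := seqSpace p N X)
    (seqSpace_invariant _ fun _ hx =>
      Set.Finite.preimage (f := fun i => i - α) sub_left_injective.injOn hx)

/-- The multiplication operator `(a x)_i = a_i x_i` on `l^p(ℤ^N, X)`, for a bounded sequence `a`
of bounded linear operators on `X`. -/
def mulOp (a : lp (fun _ : Fin N → ℤ => X →L[ℂ] X) ∞) : Op p N X :=
  (ambientMul a).restrict (p := seqSpace p N X) (q := seqSpace p N X)
    (seqSpace_invariant _ fun _ hx => Set.Finite.subset hx fun i hi h0 =>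
      hi ((congrArg (a i) h0).trans (map_zero (a i))))

lemma shift_apply (α : Fin N → ℤ) (x : LpSeq p N X) (i : Fin N → ℤ) :
    shift α x i = x (i - α) := rfl

lemma mulOp_apply (a : lp (fun _ : Fin N → ℤ => X →L[ℂ] X) ∞) (x : LpSeq p N X)
    (i : Fin N → ℤ) : mulOp a x i = a i (x i) := rfl

open Classical in
/-- The characteristic function of the cube `{-n, …, n}^N`, with values in `{0, I} ⊆ L(X)`. -/
def cubeIndicator (N : ℕ) (X : Type*) [NormedAddCommGroup X] [NormedSpace ℂ X] (n : ℕ) :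
    lp (fun _ : Fin N → ℤ => X →L[ℂ] X) ∞ :=
  ⟨fun k => if ∀ j, -(n : ℤ) ≤ k j ∧ k j ≤ n then ContinuousLinearMap.id ℂ X else 0, by
    refine memℓp_infty ⟨‖ContinuousLinearMap.id ℂ X‖, ?_⟩
    rintro _ ⟨k, rfl⟩
    dsimp only
    split_ifs
    · exact le_rfl
    · simp⟩

/-- The canonical projection `P_n` of `l^p(ℤ^N, X)`: restriction to the cube `{-n, …, n}^N`. -/
def proj (n : ℕ) : Op p N X := mulOp (cubeIndicator N X n)

/-! ### Band and band-dominated operators -/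

/-- Band operators: finite sums `∑ a_α V_α` with multiplication operators `a_α`. -/
def IsBand (A : Op p N X) : Prop :=
  ∃ (s : Finset (Fin N → ℤ)) (a : (Fin N → ℤ) → lp (fun _ : Fin N → ℤ => X →L[ℂ] X) ∞),
    A = ∑ α ∈ s, mulOp (a α) ∘L shift α

/-- Band-dominated operators: the closure of the band operators in the operator norm. -/
def IsBandDominated (A : Op p N X) : Prop :=
  A ∈ closure {B : Op p N X | IsBand B}

/-! ### `P`-compactness, `P`-convergence, limit operators -/

/-- `K` is `P`-compact if `‖(I - P_n) K‖ + ‖K (I - P_n)‖ → 0`. -/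
def IsPCompact (K : Op p N X) : Prop :=
  Tendsto (fun n : ℕ => ‖(1 - proj n) ∘L K‖ + ‖K ∘L (1 - proj n)‖) atTop (𝓝 0)

variable (p N X) in
/-- The linear space `K(𝐗, P)` of all `P`-compact operators. -/
def pCompacts : Submodule ℂ (Op p N X) where
  carrier := {K | IsPCompact K}
  add_mem' := by
    intro K L hK hL
    have h := Tendsto.add (show IsPCompact K from hK) (show IsPCompact L from hL)
    rw [add_zero] at h
    refine squeeze_zero (fun n => by positivity) (fun n => ?_) h
    rw [ContinuousLinearMap.comp_add, ContinuousLinearMap.add_comp]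
    have h1 := norm_add_le ((1 - proj n) ∘L K) ((1 - proj n) ∘L L)
    have h2 := norm_add_le (K ∘L (1 - proj n)) (L ∘L (1 - proj n))
    linarith
  zero_mem' := by
    simp only [Set.mem_ofPred_eq, IsPCompact, ContinuousLinearMap.comp_zero,
      ContinuousLinearMap.zero_comp, norm_zero, add_zero]
    exact tendsto_const_nhds
  smul_mem' := by
    intro c K hK
    have h := (show IsPCompact K from hK).const_mul ‖c‖
    rw [mul_zero] at h
    refine h.congr fun n => ?_
    rw [ContinuousLinearMap.comp_smul, ContinuousLinearMap.smul_comp, norm_smul, norm_smul]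
    ring

/-- `A_n → A` `P`-strongly: `‖K (A_n - A)‖ + ‖(A_n - A) K‖ → 0` for every `P`-compact `K`. -/
def PTendsto (A : ℕ → Op p N X) (B : Op p N X) : Prop :=
  ∀ K : Op p N X, IsPCompact K →
    Tendsto (fun n => ‖K ∘L (A n - B)‖ + ‖(A n - B) ∘L K‖) atTop (𝓝 0)

/-- A sequence in `ℤ^N` tends to infinity if `|h_n| → ∞`. -/
def TendsToInfinity (h : ℕ → Fin N → ℤ) : Prop :=
  Tendsto (fun n => ‖h n‖) atTop atTop

/-- `B` is the limit operator `A_h` of `A`, that is, the `P`-limit of `V_{-h_n} A V_{h_n}`. -/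
def IsLimitOp (A : Op p N X) (h : ℕ → Fin N → ℤ) (B : Op p N X) : Prop :=
  PTendsto (fun n => shift (-h n) ∘L A ∘L shift (h n)) B

/-- The operator spectrum of `A`: the set of all its limit operators. -/
def operatorSpectrum (A : Op p N X) : Set (Op p N X) :=
  {B | ∃ h : ℕ → Fin N → ℤ, TendsToInfinity h ∧ IsLimitOp A h B}

/-- `A` is rich: every sequence tending to infinity has a subsequence with respect to which the
limit operator of `A` exists. -/
def IsRich (A : Op p N X) : Prop :=
  ∀ h : ℕ → Fin N → ℤ, TendsToInfinity h →
    ∃ φ : ℕ → ℕ, StrictMono φ ∧ ∃ B : Op p N X, IsLimitOp A (h ∘ φ) B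

/-- The `P`-essential norm `‖A + K(𝐗, P)‖` of `A`: the quotient norm of its coset modulo the
`P`-compact operators. -/
def pEssNorm (A : Op p N X) : ℝ :=
  ‖(Submodule.Quotient.mk A : Op p N X ⧸ pCompacts p N X)‖

end Spaces

end

end LimitOps

/-! Write `Q n` for `1 - proj n`. Limit operators do not see `P`-compact operators: shifted to
infinity, such an operator vanishes in norm on every fixed cube. Hence `‖B‖ ≤ ‖A + K‖` for every
limit operator `B` and every `P`-compact `K` (`norm_limitOp_le`).

Conversely, let `μ` be the essential norm. Since `A` and `A Q n` differ by a `P`-compact operator,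
`‖A Q n‖ ≥ μ` for all `n`, so `A` has almost norming vectors `x n` supported outside the `n`-th
cube. A band-dominated operator nearly keeps its gain on the restriction of a vector to some cube,
whose radius depends only on `A` and the permitted loss (`IsBandDominated.localization`).

One localization per `n` would only show that the supremum equals `μ`. For it to be attained, `x n`
is localized repeatedly, with losses `η k - η (k + 1)` that telescope
(`exists_nested_localization`). A point `c n` common to all these cubes satisfies `‖A P‖ ≥ r n - η k
+ η n` for every `k < n`, where `P` restricts to the cube of radius `2 * D k` about `c n` and `r n →
μ`. As `c n` lies in the support of `x n`, it tends to infinity; richness yields one limit operator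
`B` with `‖B‖ ≥ μ - η k` for all `k`. -/

namespace LimitOps

noncomputable section

/-! ### Entries and norms in the sequence spaces -/

section Basic

variable {p : ℝ≥0∞} [Fact (p = 0 ∨ 1 ≤ p)] {N : ℕ}
  {X : Type*} [NormedAddCommGroup X] [NormedSpace ℂ X]

lemma LpSeq.ext {x y : LpSeq p N X} (h : ∀ i, x i = y i) : x = y :=
  Subtype.ext (lp.ext (funext h))

lemma LpSeq.add_apply (x y : LpSeq p N X) (i : Fin N → ℤ) : (x + y) i = x i + y i := rfl

lemma LpSeq.sub_apply (x y : LpSeq p N X) (i : Fin N → ℤ) : (x - y) i = x i - y i := rfl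

lemma LpSeq.zero_apply (i : Fin N → ℤ) : (0 : LpSeq p N X) i = 0 := rfl

lemma LpSeq.sum_apply {ι : Type*} (s : Finset ι) (f : ι → LpSeq p N X) (i : Fin N → ℤ) :
    (∑ k ∈ s, f k) i = ∑ k ∈ s, f k i := by
  classical
  induction s using Finset.induction_on with
  | empty => simp [LpSeq.zero_apply]
  | insert a s ha ih => rw [Finset.sum_insert ha, Finset.sum_insert ha, LpSeq.add_apply, ih]

lemma LpSeq.norm_def (x : LpSeq p N X) : ‖x‖ = ‖(Subtype.val x : Ambient (ambientExp p) N X)‖ := rfl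

lemma ambientExp_cases (p : ℝ≥0∞) [Fact (p = 0 ∨ 1 ≤ p)] :
    ambientExp p = ∞ ∨ 0 < (ambientExp p).toReal := by
  rcases (ambientExp p).trichotomy with h | h | h
  · have : 1 ≤ ambientExp p := Fact.out
    simp [h] at this
  · exact Or.inl h
  · exact Or.inr h

lemma ambientExp_ne_zero (p : ℝ≥0∞) [Fact (p = 0 ∨ 1 ≤ p)] : ambientExp p ≠ 0 := by
  have : 1 ≤ ambientExp p := Fact.out
  exact (zero_lt_one.trans_le this).ne'

lemma LpSeq.norm_apply_le (x : LpSeq p N X) (i : Fin N → ℤ) : ‖x i‖ ≤ ‖x‖ :=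
  lp.norm_apply_le_norm (ambientExp_ne_zero p) _ i

/-- A sequence is bounded in norm by `C` if on every finite set it is dominated by a sequence of
norm at most `C`. -/
lemma LpSeq.norm_le_of_finset {x : LpSeq p N X} {C : ℝ} (hC : 0 ≤ C)
    (h : ∀ s : Finset (Fin N → ℤ), ∃ y : LpSeq p N X, ‖y‖ ≤ C ∧ ∀ i ∈ s, ‖x i‖ ≤ ‖y i‖) :
    ‖x‖ ≤ C := by
  rw [LpSeq.norm_def]
  rcases ambientExp_cases p with hq | hq
  · have key : ∀ i, ‖x i‖ ≤ C := fun i => by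
      obtain ⟨y, hy, hxy⟩ := h {i}
      exact (hxy i (by simp)).trans ((y.norm_apply_le i).trans hy)
    have gen : ∀ (q : ℝ≥0∞) (_ : q = ∞) (z : Ambient q N X), (∀ i, ‖z i‖ ≤ C) → ‖z‖ ≤ C := by
      rintro q rfl z hz
      exact lp.norm_le_of_forall_le hC hz
    exact gen _ hq _ key
  · refine lp.norm_le_of_forall_sum_le hq hC fun s => ?_
    obtain ⟨y, hy, hxy⟩ := h s
    calc ∑ i ∈ s, ‖x i‖ ^ (ambientExp p).toReal
        ≤ ∑ i ∈ s, ‖y i‖ ^ (ambientExp p).toReal :=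
          Finset.sum_le_sum fun i hi => Real.rpow_le_rpow (norm_nonneg _) (hxy i hi) hq.le
      _ ≤ ‖y‖ ^ (ambientExp p).toReal := lp.sum_rpow_le_norm_rpow hq _ s
      _ ≤ C ^ (ambientExp p).toReal := Real.rpow_le_rpow (norm_nonneg _) hy hq.le

lemma LpSeq.norm_mono {x y : LpSeq p N X} (h : ∀ i, ‖x i‖ ≤ ‖y i‖) : ‖x‖ ≤ ‖y‖ :=
  LpSeq.norm_le_of_finset (norm_nonneg _) fun _ => ⟨y, le_rfl, fun i _ => h i⟩

/-! ### Restriction to subsets -/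

open Classical in
/-- The characteristic function of `S`, with values in `{0, I} ⊆ L(X)`. -/
def setIndicator (X : Type*) [NormedAddCommGroup X] [NormedSpace ℂ X] (S : Set (Fin N → ℤ)) :
    lp (fun _ : Fin N → ℤ => X →L[ℂ] X) ∞ :=
  ⟨fun k => if k ∈ S then ContinuousLinearMap.id ℂ X else 0, by
    refine memℓp_infty ⟨‖ContinuousLinearMap.id ℂ X‖, ?_⟩
    rintro _ ⟨k, rfl⟩
    dsimp only
    split_ifs
    · exact le_rfl
    · simp⟩

/-- Restriction of sequences to `S`. -/
def cut (S : Set (Fin N → ℤ)) : Op p N X := mulOp (setIndicator X S)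

open Classical in
lemma cut_apply (S : Set (Fin N → ℤ)) (x : LpSeq p N X) (i : Fin N → ℤ) :
    cut S x i = if i ∈ S then x i else 0 := by
  change (if i ∈ S then ContinuousLinearMap.id ℂ X else 0) (x i) = _
  split_ifs <;> rfl

lemma cut_apply_of_mem {S : Set (Fin N → ℤ)} (x : LpSeq p N X) {i : Fin N → ℤ} (hi : i ∈ S) :
    cut S x i = x i := by simp [cut_apply, hi]

lemma cut_apply_of_notMem {S : Set (Fin N → ℤ)} (x : LpSeq p N X) {i : Fin N → ℤ} (hi : i ∉ S) :
    cut S x i = 0 := by simp [cut_apply, hi]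

lemma norm_cut_apply_le (S : Set (Fin N → ℤ)) (x : LpSeq p N X) : ‖cut S x‖ ≤ ‖x‖ := by
  refine LpSeq.norm_mono fun i => ?_
  rw [cut_apply]
  split_ifs <;> simp

lemma norm_cut_le (S : Set (Fin N → ℤ)) : ‖(cut S : Op p N X)‖ ≤ 1 :=
  ContinuousLinearMap.opNorm_le_bound _ zero_le_one fun x => by
    simpa using norm_cut_apply_le S x

lemma cut_comp_cut (S T : Set (Fin N → ℤ)) : (cut S : Op p N X) ∘L cut T = cut (S ∩ T) := by
  ext x
  refine LpSeq.ext fun i => ?_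
  simp only [ContinuousLinearMap.comp_apply, cut_apply, Set.mem_inter_iff]
  split_ifs <;> simp_all

lemma cut_empty : (cut ∅ : Op p N X) = 0 := by
  ext x
  refine LpSeq.ext fun i => ?_
  rw [cut_apply_of_notMem _ (Set.notMem_empty i)]
  rfl

lemma one_sub_cut (S : Set (Fin N → ℤ)) : (1 - cut S : Op p N X) = cut Sᶜ := by
  ext x
  refine LpSeq.ext fun i => ?_
  simp only [_root_.sub_apply, one_apply_eq_self, LpSeq.sub_apply,
    cut_apply, Set.mem_compl_iff]
  split_ifs <;> simp_all

lemma mem_cube_iff (n : ℕ) (k : Fin N → ℤ) :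
    (∀ j, -(n : ℤ) ≤ k j ∧ k j ≤ n) ↔ k ∈ Metric.closedBall (0 : Fin N → ℤ) n := by
  rw [mem_closedBall_zero_iff, pi_norm_le_iff_of_nonneg (by positivity)]
  refine forall_congr' fun j => ?_
  rw [Int.norm_eq_abs, ← abs_le]
  exact_mod_cast Iff.rfl

lemma proj_eq_cut (n : ℕ) : (proj n : Op p N X) = cut (Metric.closedBall 0 n) := by
  ext x
  refine LpSeq.ext fun i => ?_
  rw [cut_apply]
  change (if ∀ j, -(n : ℤ) ≤ i j ∧ i j ≤ n then ContinuousLinearMap.id ℂ X else 0) (x i) = _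
  have h := mem_cube_iff n i
  split_ifs with h1 h2 h2
  · rfl
  · exact absurd (h.1 h1) h2
  · exact absurd (h.2 h2) h1
  · rfl

lemma one_sub_proj (n : ℕ) :
    (1 - proj n : Op p N X) = cut (Metric.closedBall (0 : Fin N → ℤ) n)ᶜ := by
  rw [proj_eq_cut, one_sub_cut]

lemma exists_finset_subset_closedBall (s : Finset (Fin N → ℤ)) :
    ∃ n : ℕ, ∀ i ∈ s, i ∈ Metric.closedBall (0 : Fin N → ℤ) n := by
  obtain ⟨n, hn⟩ := exists_nat_ge (∑ i ∈ s, ‖i‖)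
  refine ⟨n, fun i hi => mem_closedBall_zero_iff.2 (le_trans ?_ hn)⟩
  exact Finset.single_le_sum (f := fun i => ‖i‖) (fun _ _ => norm_nonneg _) hi

/-- Every finite set of indices lies in some cube. This replaces strong convergence of `proj n` to
the identity, which can fail for `p = ∞`. -/
lemma norm_le_of_norm_proj_le {x : LpSeq p N X} {C : ℝ} (hC : 0 ≤ C)
    (h : ∀ n, ‖proj n x‖ ≤ C) : ‖x‖ ≤ C := by
  refine LpSeq.norm_le_of_finset hC fun s => ?_
  obtain ⟨n, hn⟩ := exists_finset_subset_closedBall s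
  refine ⟨proj n x, h n, fun i hi => ?_⟩
  rw [proj_eq_cut, cut_apply_of_mem _ (hn i hi)]

lemma opNorm_le_of_proj_comp_le {B : Op p N X} {C : ℝ} (hC : 0 ≤ C)
    (h : ∀ n, ‖proj n ∘L B‖ ≤ C) : ‖B‖ ≤ C :=
  ContinuousLinearMap.opNorm_le_bound _ hC fun x =>
    norm_le_of_norm_proj_le (by positivity) fun n =>
      ((proj n ∘L B).le_opNorm x).trans (by gcongr; exact h n)

/-! ### Shifts -/

lemma shift_comp_shift_neg (α : Fin N → ℤ) : (shift α : Op p N X) ∘L shift (-α) = 1 := by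
  ext x
  refine LpSeq.ext fun i => ?_
  simp [shift_apply]

lemma norm_shift_apply_le (α : Fin N → ℤ) (x : LpSeq p N X) : ‖shift α x‖ ≤ ‖x‖ := by
  have h : ‖(ambientShift α : Ambient (ambientExp p) N X →L[ℂ] _)‖ ≤ 1 :=
    LinearMap.mkContinuous_norm_le _ zero_le_one _
  refine (ContinuousLinearMap.le_of_opNorm_le _ h (Subtype.val x)).trans ?_
  rw [one_mul]
  exact le_rfl

lemma norm_shift_le (α : Fin N → ℤ) : ‖(shift α : Op p N X)‖ ≤ 1 :=
  ContinuousLinearMap.opNorm_le_bound _ zero_le_one fun x => by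
    simpa using norm_shift_apply_le α x

lemma cut_comp_shift (c : Fin N → ℤ) (r : ℝ) :
    (cut (Metric.closedBall c r) : Op p N X) ∘L shift c =
      shift c ∘L cut (Metric.closedBall 0 r) := by
  ext x
  refine LpSeq.ext fun i => ?_
  simp only [ContinuousLinearMap.comp_apply, cut_apply, shift_apply, mem_closedBall_iff_norm,
    sub_zero]

lemma shift_neg_comp_cut (c : Fin N → ℤ) (r : ℝ) :
    (shift (-c) : Op p N X) ∘L cut (Metric.closedBall c r) =
      cut (Metric.closedBall 0 r) ∘L shift (-c) := by
  ext x
  refine LpSeq.ext fun i => ?_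
  simp only [ContinuousLinearMap.comp_apply, cut_apply, shift_apply, mem_closedBall_iff_norm,
    sub_zero, sub_neg_eq_add, add_sub_cancel_right]

lemma norm_shift_comp_le (α : Fin N → ℤ) (A : Op p N X) : ‖shift α ∘L A‖ ≤ ‖A‖ :=
  (ContinuousLinearMap.opNorm_comp_le _ _).trans
    (mul_le_of_le_one_left (norm_nonneg _) (norm_shift_le α))

lemma norm_comp_shift_le (α : Fin N → ℤ) (A : Op p N X) : ‖A ∘L shift α‖ ≤ ‖A‖ :=
  (ContinuousLinearMap.opNorm_comp_le _ _).trans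
    (mul_le_of_le_one_right (norm_nonneg _) (norm_shift_le α))

lemma norm_cut_comp_le (S : Set (Fin N → ℤ)) (A : Op p N X) : ‖cut S ∘L A‖ ≤ ‖A‖ :=
  (ContinuousLinearMap.opNorm_comp_le _ _).trans
    (mul_le_of_le_one_left (norm_nonneg _) (norm_cut_le S))

lemma norm_comp_cut_le (S : Set (Fin N → ℤ)) (A : Op p N X) : ‖A ∘L cut S‖ ≤ ‖A‖ :=
  (ContinuousLinearMap.opNorm_comp_le _ _).trans
    (mul_le_of_le_one_right (norm_nonneg _) (norm_cut_le S))

lemma norm_conj_shift_le (α β : Fin N → ℤ) (A : Op p N X) :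
    ‖shift α ∘L A ∘L shift β‖ ≤ ‖A‖ :=
  (norm_shift_comp_le _ _).trans (norm_comp_shift_le _ _)

end Basic

/-! ### Localization of the norm on cubes -/

section Localization

variable {p : ℝ≥0∞} [Fact (p = 0 ∨ 1 ≤ p)] {N : ℕ}
  {X : Type*} [NormedAddCommGroup X] [NormedSpace ℂ X]

/-- `B` has band-width at most `w` if `(B x)_i` vanishes whenever `x` vanishes on the cube of radius
`w` around `i`. -/
def HasBandWidth (B : Op p N X) (w : ℕ) : Prop :=
  ∀ (x : LpSeq p N X) (i : Fin N → ℤ), (∀ j ∈ Metric.closedBall i w, x j = 0) → B x i = 0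

lemma IsBand.exists_hasBandWidth {B : Op p N X} (hB : IsBand B) : ∃ w, HasBandWidth B w := by
  obtain ⟨s, a, rfl⟩ := hB
  obtain ⟨w, hw⟩ := exists_finset_subset_closedBall s
  refine ⟨w, fun x i hx => ?_⟩
  rw [_root_.sum_apply, LpSeq.sum_apply]
  refine Finset.sum_eq_zero fun α hα => ?_
  rw [ContinuousLinearMap.comp_apply, mulOp_apply, shift_apply, hx, map_zero]
  simpa [dist_eq_norm] using hw α hα

lemma HasBandWidth.apply_congr {B : Op p N X} {w : ℕ} (hB : HasBandWidth B w)
    {x y : LpSeq p N X} {i : Fin N → ℤ} (h : ∀ j ∈ Metric.closedBall i w, x j = y j) :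
    B x i = B y i := by
  rw [← sub_eq_zero, ← LpSeq.sub_apply, ← map_sub]
  exact hB _ _ fun j hj => by rw [LpSeq.sub_apply, h j hj, sub_self]

lemma HasBandWidth.apply_cut {B : Op p N X} {w : ℕ} (hB : HasBandWidth B w)
    (x : LpSeq p N X) {i : Fin N → ℤ} {T : Set (Fin N → ℤ)} (h : Metric.closedBall i w ⊆ T) :
    B (cut T x) i = B x i :=
  hB.apply_congr fun _ hj => cut_apply_of_mem x (h hj)

lemma HasBandWidth.cut_comp_comp_cut {B : Op p N X} {w : ℕ} (hB : HasBandWidth B w)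
    {S T : Set (Fin N → ℤ)} (h : ∀ i ∈ S, Disjoint (Metric.closedBall i w) T) :
    cut S ∘L B ∘L cut T = 0 := by
  ext x
  refine LpSeq.ext fun i => ?_
  change cut S (B (cut T x)) i = 0
  by_cases hi : i ∈ S
  · rw [cut_apply_of_mem _ hi]
    exact hB _ _ fun j hj => cut_apply_of_notMem _ fun hT =>
      Set.disjoint_left.1 (h i hi) hj hT
  · exact cut_apply_of_notMem _ hi

/-- Each index is counted once for every element of `T`. -/
lemma hasSum_sum_translates {G : Type*} [AddGroup G] {f : G → ℝ} {a : ℝ} (hf : HasSum f a)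
    (T : Finset G) : HasSum (fun c => ∑ j ∈ T, f (c + j)) (T.card * a) := by
  have h := hasSum_sum (s := T) (f := fun j c => f (c + j)) (a := fun _ => a)
    fun j _ => (Equiv.addRight j).hasSum_iff.2 hf
  rwa [Finset.sum_const, nsmul_eq_mul] at h

lemma LpSeq.hasSum_translates (hq : 0 < (ambientExp p).toReal) (x : LpSeq p N X)
    (T : Finset (Fin N → ℤ)) :
    HasSum (fun c => ∑ j ∈ T, ‖x (c + j)‖ ^ (ambientExp p).toReal)
      (T.card * ‖x‖ ^ (ambientExp p).toReal) :=
  hasSum_sum_translates (f := fun i => ‖x i‖ ^ (ambientExp p).toReal) (lp.hasSum_norm hq _) T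

lemma mem_Icc_iff_norm_le (n : ℕ) (k : Fin N → ℤ) :
    k ∈ Finset.Icc (fun _ => -(n : ℤ)) (fun _ : Fin N => (n : ℤ)) ↔ ‖k‖ ≤ n := by
  rw [← mem_closedBall_zero_iff, ← mem_cube_iff, Finset.mem_Icc, Pi.le_def, Pi.le_def,
    forall_and]

lemma card_cube (n : ℕ) :
    (Finset.Icc (fun _ => -(n : ℤ)) (fun _ : Fin N => (n : ℤ))).card = (2 * n + 1) ^ N := by
  rw [Pi.card_Icc]
  simp only [Int.card_Icc, Finset.prod_const, Finset.card_univ, Fintype.card_fin]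
  congr 1
  omega

lemma LpSeq.norm_cut_rpow_le (hq : 0 < (ambientExp p).toReal) (x : LpSeq p N X)
    (c : Fin N → ℤ) (D : ℕ) :
    ‖cut (Metric.closedBall c D) x‖ ^ (ambientExp p).toReal ≤
      ∑ j ∈ Finset.Icc (fun _ => -(D : ℤ)) (fun _ : Fin N => (D : ℤ)),
        ‖x (c + j)‖ ^ (ambientExp p).toReal := by
  have h0 : HasSum (fun i => ‖cut (Metric.closedBall c D) x i‖ ^ (ambientExp p).toReal)
    (‖cut (Metric.closedBall c D) x‖ ^ (ambientExp p).toReal) := lp.hasSum_norm hq _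
  have h1 := (Equiv.addLeft c).hasSum_iff.2 h0
  refine le_of_eq (h1.unique ?_)
  have h2 : ∀ j, ((fun i => ‖cut (Metric.closedBall c D) x i‖ ^ (ambientExp p).toReal) ∘
      (Equiv.addLeft c)) j = if ‖j‖ ≤ D then ‖x (c + j)‖ ^ (ambientExp p).toReal else 0 := by
    intro j
    simp only [Function.comp_apply, Equiv.coe_addLeft, cut_apply, mem_closedBall_iff_norm,
      add_sub_cancel_left]
    split_ifs
    · rfl
    · rw [norm_zero, Real.zero_rpow hq.ne']
  rw [funext h2]
  have h3 := hasSum_sum_of_ne_finset_zero (L := SummationFilter.unconditional _)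
    (s := Finset.Icc (fun _ => -(D : ℤ)) (fun _ : Fin N => (D : ℤ)))
    (f := fun j => if ‖j‖ ≤ D then ‖x (c + j)‖ ^ (ambientExp p).toReal else 0)
    fun j hj => if_neg fun h => hj ((mem_Icc_iff_norm_le D j).2 h)
  convert h3 using 1
  exact Finset.sum_congr rfl fun j hj => (if_pos ((mem_Icc_iff_norm_le D j).1 hj)).symm

/-- The averaging inequality behind localization for finite exponents: inner cubes of radius `D`
are compared to outer cubes of radius `D + w`. -/
lemma HasBandWidth.card_mul_norm_rpow_le (hq : 0 < (ambientExp p).toReal) {B : Op p N X} {w : ℕ}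
    (hB : HasBandWidth B w) (D : ℕ) {x : LpSeq p N X} {r : ℝ} (hr : 0 ≤ r)
    (h : ∀ c, ‖B (cut (Metric.closedBall c ((D + w : ℕ) : ℝ)) x)‖ ≤
      r * ‖cut (Metric.closedBall c ((D + w : ℕ) : ℝ)) x‖) :
    ((2 * D + 1) ^ N : ℕ) * ‖B x‖ ^ (ambientExp p).toReal ≤
      r ^ (ambientExp p).toReal *
        (((2 * (D + w) + 1) ^ N : ℕ) * ‖x‖ ^ (ambientExp p).toReal) := by
  have hl := (B x).hasSum_translates hq (Finset.Icc (fun _ => -(D : ℤ)) (fun _ => (D : ℤ)))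
  have hr' := (x.hasSum_translates hq
    (Finset.Icc (fun _ => -((D + w : ℕ) : ℤ)) (fun _ => ((D + w : ℕ) : ℤ)))).mul_left
      (r ^ (ambientExp p).toReal)
  rw [card_cube] at hl hr'
  refine hasSum_le (fun c => ?_) hl hr'
  set y := cut (Metric.closedBall c ((D + w : ℕ) : ℝ)) x with hy
  calc ∑ j ∈ Finset.Icc (fun _ => -(D : ℤ)) (fun _ => (D : ℤ)),
        ‖B x (c + j)‖ ^ (ambientExp p).toReal
      = ∑ j ∈ Finset.Icc (fun _ => -(D : ℤ)) (fun _ => (D : ℤ)),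
        ‖B y (c + j)‖ ^ (ambientExp p).toReal := by
        -- On the cube of radius `D` about `c`, the values of `B x` depend only on `x` in the cube
        -- of radius `D + w`.
        refine Finset.sum_congr rfl fun j hj => ?_
        rw [hy, hB.apply_cut]
        refine Metric.closedBall_subset_closedBall' ?_
        have := (mem_Icc_iff_norm_le D j).1 hj
        rw [dist_eq_norm, add_sub_cancel_left]
        push_cast
        linarith
    _ = ∑ j ∈ (Finset.Icc (fun _ => -(D : ℤ)) (fun _ => (D : ℤ))).map
          (Equiv.addLeft c).toEmbedding, ‖B y j‖ ^ (ambientExp p).toReal := by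
        rw [Finset.sum_map]; rfl
    _ ≤ ‖B y‖ ^ (ambientExp p).toReal := lp.sum_rpow_le_norm_rpow hq _ _
    _ ≤ (r * ‖y‖) ^ (ambientExp p).toReal :=
        Real.rpow_le_rpow (norm_nonneg _) (h c) hq.le
    _ = r ^ (ambientExp p).toReal * ‖y‖ ^ (ambientExp p).toReal :=
        Real.mul_rpow hr (norm_nonneg _)
    _ ≤ _ := by
        gcongr
        exact x.norm_cut_rpow_le hq c (D + w)

/-- The ratio is `(1 + 2w / (2D + 1)) ^ N`; it is the loss in the averaging inequality. -/
lemma tendsto_cube_ratio (N w : ℕ) :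
    Tendsto (fun D : ℕ => (((2 * (D + w) + 1) ^ N : ℕ) : ℝ) / ((2 * D + 1) ^ N : ℕ)) atTop
      (𝓝 1) := by
  have h1 : Tendsto (fun D : ℕ => ((2 * w : ℕ) : ℝ) / ((2 * D + 1 : ℕ) : ℝ)) atTop (𝓝 0) := by
    refine tendsto_const_nhds.div_atTop (tendsto_natCast_atTop_atTop.comp ?_)
    exact tendsto_atTop_mono (fun n => by dsimp; omega) tendsto_id
  have h2 := (h1.const_add 1).pow N
  rw [add_zero, one_pow] at h2
  refine h2.congr fun D => ?_
  have : ((2 * D + 1 : ℕ) : ℝ) ≠ 0 := by positivity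
  push_cast at this ⊢
  rw [← div_pow]
  congr 1
  field_simp
  ring

/-- In the supremum norm each entry of `B x` is controlled by one cube of radius `w`, without loss.
For finite exponents, averaging over all centers loses only the cube ratio, which is below `(1 + η)
^ q` for large `D`, where `q` is the exponent. -/
lemma HasBandWidth.localization {B : Op p N X} {w : ℕ} (hB : HasBandWidth B w) {η : ℝ}
    (hη : 0 < η) : ∃ D : ℕ, ∀ (x : LpSeq p N X) (r : ℝ), 0 ≤ r →
      (∀ c, ‖B (cut (Metric.closedBall c D) x)‖ ≤ r * ‖cut (Metric.closedBall c D) x‖) →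
      ‖B x‖ ≤ (1 + η) * (r * ‖x‖) := by
  rcases ambientExp_cases p with hq | hq
  · refine ⟨w, fun x r hr h => ?_⟩
    have key : ∀ i, ‖B x i‖ ≤ r * ‖x‖ := fun i => by
      rw [← hB.apply_cut x (T := Metric.closedBall i w) le_rfl]
      refine (LpSeq.norm_apply_le _ i).trans ((h i).trans ?_)
      gcongr
      exact norm_cut_apply_le _ _
    have gen : ∀ (q : ℝ≥0∞) (_ : q = ∞) (z : Ambient q N X), (∀ i, ‖z i‖ ≤ r * ‖x‖) →
        ‖z‖ ≤ r * ‖x‖ := by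
      rintro q rfl z hz
      exact lp.norm_le_of_forall_le (by positivity) hz
    refine (gen _ hq _ key).trans (le_mul_of_one_le_left (by positivity) (by linarith))
  · have h1 : (1 : ℝ) < (1 + η) ^ (ambientExp p).toReal :=
      Real.one_lt_rpow (by linarith) hq
    obtain ⟨D, hD⟩ := ((tendsto_cube_ratio N w).eventually (gt_mem_nhds h1)).exists
    refine ⟨D + w, fun x r hr h => ?_⟩
    have h2 := hB.card_mul_norm_rpow_le hq D hr h
    have hpos : (0 : ℝ) < ((2 * D + 1) ^ N : ℕ) := by positivity
    rw [div_lt_iff₀ hpos] at hD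
    refine (Real.rpow_le_rpow_iff (norm_nonneg _) (by positivity) hq).1 ?_
    rw [Real.mul_rpow (by positivity) (by positivity), Real.mul_rpow hr (norm_nonneg _)]
    refine le_of_mul_le_mul_left (h2.trans ?_) hpos
    have h3 : 0 ≤ r ^ (ambientExp p).toReal * ‖x‖ ^ (ambientExp p).toReal := by positivity
    nlinarith [mul_le_mul_of_nonneg_right hD.le h3]

/-- Localization of the norm of a band-dominated operator: if `‖A x‖ > (r + δ) ‖x‖`, then
`‖A y‖ > r ‖y‖` for the restriction `y` of `x` to some cube of a radius depending on `A` and `δ`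
only. -/
lemma IsBandDominated.localization {A : Op p N X} (hA : IsBandDominated A) {δ : ℝ} (hδ : 0 < δ) :
    ∃ D : ℕ, ∀ (x : LpSeq p N X) (r : ℝ), (r + δ) * ‖x‖ < ‖A x‖ →
      ∃ c, r * ‖cut (Metric.closedBall c D) x‖ < ‖A (cut (Metric.closedBall c D) x)‖ := by
  -- A quarter of `δ` each pays for replacing `A` by `B` on the cubes, for the factor `1 + η`, and
  -- for returning from `B` to `A` on `x`.
  obtain ⟨B, hB, hAB⟩ := Metric.mem_closure_iff.1 hA (δ / 4) (by positivity)
  rw [dist_eq_norm] at hAB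
  obtain ⟨w, hw⟩ := IsBand.exists_hasBandWidth hB
  have hclose : ∀ z, ‖A z - B z‖ ≤ δ / 4 * ‖z‖ := fun z =>
    ((A - B).le_opNorm z).trans (by gcongr)
  set M := ‖A‖ + δ with hM
  have hMpos : 0 < M := by positivity
  obtain ⟨D, hD⟩ := hw.localization (η := δ / (4 * M)) (by positivity)
  refine ⟨D, fun x r => ?_⟩
  contrapose!
  intro h
  -- In the remaining case `r + δ / 4 < M`, so the factor `1 + δ / (4 * M)` serves all `r` at once.
  rcases le_or_gt ‖A‖ (r + δ) with hrA | hrA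
  · exact (A.le_opNorm x).trans (by gcongr)
  rcases lt_or_ge r 0 with hr | hr
  · have hx : x = 0 := LpSeq.ext fun i => by
      have h1 := h i
      have h2 : ‖cut (Metric.closedBall i (D : ℝ)) x‖ ≤ 0 := by
        by_contra! hc
        nlinarith [norm_nonneg (A (cut (Metric.closedBall i (D : ℝ)) x))]
      rw [← cut_apply_of_mem (S := Metric.closedBall i (D : ℝ)) x
        (Metric.mem_closedBall_self (by positivity)), norm_le_zero_iff.1 h2]
    simp [hx]
  have h1 := hD x (r + δ / 4) (by positivity) fun c => by
    have h2 := hclose (cut (Metric.closedBall c D) x)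
    have h3 := norm_sub_norm_le (B (cut (Metric.closedBall c D) x))
      (A (cut (Metric.closedBall c D) x))
    rw [norm_sub_rev] at h3
    linarith [h c]
  have h2 := hclose x
  have h3 := norm_sub_norm_le (A x) (B x)
  have h4 : δ / (4 * M) * (r + δ / 4) ≤ δ / 4 := by
    rw [div_mul_eq_mul_div, div_le_div_iff₀ (by positivity) (by norm_num)]
    nlinarith
  nlinarith [norm_nonneg x]

/-- Localization along nested cubes of radii `D 0, …, D (n - 1)` with a common center. -/
lemma exists_nested_localization {A : Op p N X} {η : ℕ → ℝ} {D : ℕ → ℕ}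
    (hD : ∀ k (x : LpSeq p N X) (r : ℝ), (r + (η k - η (k + 1))) * ‖x‖ < ‖A x‖ →
      ∃ c, r * ‖cut (Metric.closedBall c (D k)) x‖ < ‖A (cut (Metric.closedBall c (D k)) x)‖)
    (n : ℕ) (x : LpSeq p N X) (r : ℝ) (hx : r * ‖x‖ < ‖A x‖) :
    ∃ c, x c ≠ 0 ∧
      ∀ k < n, r - η k + η n ≤ ‖A ∘L cut (Metric.closedBall c ((2 * D k : ℕ) : ℝ))‖ := by
  induction n generalizing x r with
  | zero =>
    have hx0 : ∃ c, x c ≠ 0 := by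
      by_contra! hc
      have : x = 0 := LpSeq.ext hc
      simp [this] at hx
    obtain ⟨c, hc⟩ := hx0
    exact ⟨c, hc, fun k hk => absurd hk (Nat.not_lt_zero k)⟩
  | succ n ih =>
    -- The last radius is used first and the others inside its cube. Requiring the final center to
    -- lie in the support puts it in every cube chosen on the way.
    obtain ⟨c₀, hc₀⟩ := hD n x (r - (η n - η (n + 1))) (by simpa using hx)
    set y := cut (Metric.closedBall c₀ (D n)) x with hy
    obtain ⟨c, hc, hk⟩ := ih y _ hc₀
    have hcm : c ∈ Metric.closedBall c₀ (D n : ℝ) := by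
      by_contra hcon
      exact hc (cut_apply_of_notMem x hcon)
    refine ⟨c, fun h0 => hc ?_, fun k hkn => ?_⟩
    · rw [hy, cut_apply_of_mem x hcm, h0]
    · rcases Nat.lt_succ_iff_lt_or_eq.1 hkn with hlt | rfl
      · linarith [hk k hlt]
      -- Since `c` lies in the cube of radius `D k` about `c₀`, doubling the radius about `c` covers
      -- that cube and hence the support of `y`.
      · have hcut : cut (Metric.closedBall c ((2 * D k : ℕ) : ℝ)) y = y := by
          rw [hy, ← ContinuousLinearMap.comp_apply, cut_comp_cut,
            Set.inter_eq_self_of_subset_right]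
          refine Metric.closedBall_subset_closedBall' ?_
          rw [dist_comm]
          have := Metric.mem_closedBall.1 hcm
          push_cast
          linarith
        have h1 := (A ∘L cut (Metric.closedBall c ((2 * D k : ℕ) : ℝ))).le_opNorm y
        rw [ContinuousLinearMap.comp_apply, hcut] at h1
        have hypos : 0 < ‖y‖ := norm_pos_iff.2 fun h0 => hc (by rw [h0]; rfl)
        have := lt_of_mul_lt_mul_right (hc₀.trans_le h1) hypos.le
        linarith

end Localization

/-! ### The essential norm and the norms of limit operators -/

section EssentialNorm

variable {p : ℝ≥0∞} [Fact (p = 0 ∨ 1 ≤ p)] {N : ℕ}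
  {X : Type*} [NormedAddCommGroup X] [NormedSpace ℂ X]

lemma comp_one_sub_proj_of_le {m n : ℕ} (h : m ≤ n) :
    (cut (Metric.closedBall 0 m) : Op p N X) ∘L (1 - proj n) = 0 := by
  rw [one_sub_proj, cut_comp_cut, ← cut_empty]
  congr 1
  refine Set.disjoint_iff_inter_eq_empty.1 (Set.disjoint_compl_right_iff_subset.2 ?_)
  exact Metric.closedBall_subset_closedBall (by exact_mod_cast h)

lemma isPCompact_cut (m : ℕ) : IsPCompact (cut (Metric.closedBall 0 m) : Op p N X) := by
  refine tendsto_const_nhds.congr' ?_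
  filter_upwards [eventually_ge_atTop m] with n hn
  rw [comp_one_sub_proj_of_le hn, one_sub_proj, cut_comp_cut,
    Set.disjoint_iff_inter_eq_empty.1, cut_empty, norm_zero, add_zero]
  exact Set.disjoint_compl_left_iff_subset.2
    (Metric.closedBall_subset_closedBall (by exact_mod_cast hn))

/-- A band operator of width `w` maps sequences supported in the cube of radius `m` into the cube of
radius `m + w`; norm approximation does the rest. -/
lemma IsBandDominated.isPCompact_comp_cut {A : Op p N X} (hA : IsBandDominated A) (m : ℕ) :
    IsPCompact (A ∘L cut (Metric.closedBall 0 m)) := by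
  rw [IsPCompact, Metric.tendsto_atTop]
  intro ε hε
  obtain ⟨B, hB, hAB⟩ := Metric.mem_closure_iff.1 hA ε hε
  rw [dist_eq_norm] at hAB
  obtain ⟨w, hw⟩ := IsBand.exists_hasBandWidth hB
  refine ⟨m + w, fun n hn => ?_⟩
  have hmn : m ≤ n := by omega
  rw [Real.dist_0_eq_abs, abs_of_nonneg (by positivity), ContinuousLinearMap.comp_assoc,
    comp_one_sub_proj_of_le hmn, ContinuousLinearMap.comp_zero, norm_zero, add_zero]
  have h0 : (1 - proj n) ∘L B ∘L cut (Metric.closedBall 0 m) = 0 := by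
    rw [one_sub_proj]
    refine hw.cut_comp_comp_cut fun i hi => Set.disjoint_left.2 fun j hj hj' => hi ?_
    rw [mem_closedBall_zero_iff] at hj' ⊢
    rw [mem_closedBall_iff_norm, norm_sub_rev] at hj
    have h1 : ‖i‖ ≤ ‖i - j‖ + ‖j‖ := by simpa using norm_add_le (i - j) j
    have h2 : ((m + w : ℕ) : ℝ) ≤ n := by exact_mod_cast hn
    push_cast at h2
    linarith
  have h1 : (1 - proj n) ∘L A ∘L cut (Metric.closedBall 0 m) =
      cut (Metric.closedBall (0 : Fin N → ℤ) n)ᶜ ∘L (A - B) ∘L cut (Metric.closedBall 0 m) := by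
    rw [← one_sub_proj, ContinuousLinearMap.sub_comp A B,
      ContinuousLinearMap.comp_sub (1 - proj n), h0, sub_zero]
  rw [h1]
  exact ((norm_cut_comp_le _ _).trans (norm_comp_cut_le _ _)).trans_lt hAB

lemma IsBandDominated.pEssNorm_le {A : Op p N X} (hA : IsBandDominated A) (n : ℕ) :
    pEssNorm A ≤ ‖A ∘L cut (Metric.closedBall (0 : Fin N → ℤ) n)ᶜ‖ := by
  have h : (Submodule.Quotient.mk A : Op p N X ⧸ pCompacts p N X) =
      Submodule.Quotient.mk (A ∘L cut (Metric.closedBall (0 : Fin N → ℤ) n)ᶜ) := by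
    rw [Submodule.Quotient.eq, ← one_sub_cut, ContinuousLinearMap.comp_sub]
    change A - (A ∘L ContinuousLinearMap.id ℂ _ - _) ∈ _
    rw [ContinuousLinearMap.comp_id, sub_sub_cancel]
    exact hA.isPCompact_comp_cut n
  rw [pEssNorm, h]
  exact Submodule.Quotient.norm_mk_le (S := pCompacts p N X) _

/-- Once `‖h n‖ > m + k`, the cube of radius `m` about `h n` misses the cube of radius `k` about the
origin, so the shifted `K` contributes at most `‖(1 - proj k) ∘L K‖` there. -/
lemma norm_limitOp_le {A B K : Op p N X} (hK : IsPCompact K) {h : ℕ → Fin N → ℤ}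
    (hh : TendsToInfinity h) (hB : IsLimitOp A h B) : ‖B‖ ≤ ‖A + K‖ := by
  refine opNorm_le_of_proj_comp_le (norm_nonneg _) fun m => le_of_forall_pos_le_add fun ε hε => ?_
  have h1 := hB _ (isPCompact_cut m)
  rw [IsPCompact, Metric.tendsto_atTop] at hK
  obtain ⟨k, hk⟩ := hK (ε / 2) (by positivity)
  have hk := hk k le_rfl
  rw [Real.dist_0_eq_abs, abs_of_nonneg (by positivity)] at hk
  obtain ⟨n, hn1, hn2⟩ := ((h1.eventually (gt_mem_nhds (half_pos hε))).and
    (hh.eventually (eventually_gt_atTop ((m : ℝ) + k)))).exists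
  set c := h n
  set P : Op p N X := cut (Metric.closedBall 0 m) with hP
  have e1 : proj m ∘L B = P ∘L (shift (-c) ∘L (A + K) ∘L shift c) -
      P ∘L (shift (-c) ∘L K ∘L shift c) - P ∘L (shift (-c) ∘L A ∘L shift c - B) := by
    rw [proj_eq_cut, ← hP, ContinuousLinearMap.add_comp, ContinuousLinearMap.comp_add,
      ContinuousLinearMap.comp_add, ContinuousLinearMap.comp_sub]
    abel
  have e2 : ‖P ∘L (shift (-c) ∘L K ∘L shift c)‖ ≤ ‖(1 - proj k) ∘L K‖ := by
    have hs : P ∘L (shift (-c) ∘L K ∘L shift c) =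
        shift (-c) ∘L (cut (Metric.closedBall c m) ∘L ((1 - proj k) ∘L K)) ∘L shift c := by
      have hc : (cut (Metric.closedBall c m) : Op p N X) ∘L (1 - proj k) =
          cut (Metric.closedBall c m) := by
        rw [one_sub_proj, cut_comp_cut, Set.inter_eq_self_of_subset_left]
        intro i hi hi'
        rw [mem_closedBall_zero_iff] at hi'
        rw [mem_closedBall_iff_norm, norm_sub_rev] at hi
        have h1 : ‖c‖ ≤ ‖c - i‖ + ‖i‖ := by simpa using norm_add_le (c - i) i
        have h2 : (m : ℝ) + k < ‖c‖ := hn2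
        linarith
      rw [← ContinuousLinearMap.comp_assoc (cut _) (1 - proj k), hc, ContinuousLinearMap.comp_assoc,
        ← ContinuousLinearMap.comp_assoc (shift (-c)) (cut _), shift_neg_comp_cut]
      rfl
    rw [hs]
    exact (norm_conj_shift_le _ _ _).trans (norm_cut_comp_le _ _)
  have e3 : ‖P ∘L (shift (-c) ∘L (A + K) ∘L shift c)‖ ≤ ‖A + K‖ :=
    (norm_cut_comp_le _ _).trans (norm_conj_shift_le _ _ _)
  have e4 : ‖P ∘L (shift (-c) ∘L A ∘L shift c - B)‖ < ε / 2 :=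
    (le_add_of_nonneg_right (norm_nonneg _)).trans_lt hn1
  have e5 : ‖(1 - proj k) ∘L K‖ < ε / 2 := (le_add_of_nonneg_right (norm_nonneg _)).trans_lt hk
  rw [e1]
  refine (norm_sub_le _ _).trans ((add_le_add_left (norm_sub_le _ _) _).trans ?_)
  linarith

lemma norm_limitOp_le_pEssNorm {A B : Op p N X} (hB : B ∈ operatorSpectrum A) :
    ‖B‖ ≤ pEssNorm A := by
  obtain ⟨h, hh, hAB⟩ := hB
  refine le_of_forall_pos_le_add fun ε hε => ?_
  obtain ⟨T, hT, hTn⟩ := Submodule.Quotient.norm_mk_lt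
    (Submodule.Quotient.mk A : Op p N X ⧸ pCompacts p N X) hε
  have hK : T - A ∈ pCompacts p N X := (Submodule.Quotient.eq _).1 hT
  have := norm_limitOp_le (K := T - A) hK hh hAB
  rw [add_sub_cancel] at this
  exact this.trans hTn.le

/-- Shifting the cube about `h n` to the origin turns the restricted operator into `An ∘L P`, which
converges in norm to `B ∘L P` because `P` is `P`-compact. -/
lemma le_norm_limitOp {A B : Op p N X} {h : ℕ → Fin N → ℤ} (hB : IsLimitOp A h B) (m : ℕ)
    {μ : ℝ} {r : ℕ → ℝ} (hr : Tendsto r atTop (𝓝 μ))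
    (hA : ∀ᶠ n in atTop, r n ≤ ‖A ∘L cut (Metric.closedBall (h n) m)‖) : μ ≤ ‖B‖ := by
  set P : Op p N X := cut (Metric.closedBall 0 m) with hP
  have h1 : Tendsto (fun n => r n -
      (‖P ∘L (shift (-h n) ∘L A ∘L shift (h n) - B)‖ +
        ‖(shift (-h n) ∘L A ∘L shift (h n) - B) ∘L P‖)) atTop (𝓝 (μ - 0)) :=
    hr.sub (hB _ (isPCompact_cut m))
  rw [sub_zero] at h1
  refine le_of_tendsto h1 (hA.mono fun n hn => ?_)
  set c := h n
  set An := shift (-c) ∘L A ∘L shift c with hAn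
  have e1 : A ∘L cut (Metric.closedBall c m) = shift c ∘L (An ∘L P) ∘L shift (-c) := by
    have h2 : (cut (Metric.closedBall c m) : Op p N X) = shift c ∘L P ∘L shift (-c) := by
      rw [← ContinuousLinearMap.comp_assoc, hP, ← cut_comp_shift, ContinuousLinearMap.comp_assoc,
        shift_comp_shift_neg]
      rfl
    have h3 : shift c ∘L An = A ∘L shift c := by
      rw [hAn, ← ContinuousLinearMap.comp_assoc, shift_comp_shift_neg]
      rfl
    rw [h2, ← ContinuousLinearMap.comp_assoc, ← h3]
    rfl
  have e2 : ‖A ∘L cut (Metric.closedBall c m)‖ ≤ ‖An ∘L P‖ := by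
    rw [e1]
    exact norm_conj_shift_le _ _ _
  have e3 : ‖An ∘L P‖ ≤ ‖(An - B) ∘L P‖ + ‖B‖ := by
    have : An ∘L P = (An - B) ∘L P + B ∘L P := by
      rw [← ContinuousLinearMap.add_comp, sub_add_cancel]
    rw [this]
    exact (norm_add_le _ _).trans (by gcongr; exact norm_comp_cut_le _ _)
  linarith [norm_nonneg (P ∘L (An - B))]

lemma TendsToInfinity.of_lt {h : ℕ → Fin N → ℤ} (hh : ∀ n : ℕ, (n : ℝ) < ‖h n‖) :
    TendsToInfinity h :=
  tendsto_atTop_mono (fun n => (hh n).le) tendsto_natCast_atTop_atTop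

lemma TendsToInfinity.comp_strictMono {h : ℕ → Fin N → ℤ} (hh : TendsToInfinity h) {φ : ℕ → ℕ}
    (hφ : StrictMono φ) : TendsToInfinity (h ∘ φ) :=
  Tendsto.comp (g := fun n => ‖h n‖) hh hφ.tendsto_atTop

/-- Positivity of `N` matters: no sequence in `ℤ^0` tends to infinity. -/
lemma IsRich.operatorSpectrum_nonempty {A : Op p N X} (hN : 0 < N) (hA : IsRich A) :
    (operatorSpectrum A).Nonempty := by
  have hh : TendsToInfinity (fun n : ℕ => fun _ : Fin N => (n : ℤ) + 1) := by
    refine TendsToInfinity.of_lt fun n => lt_of_lt_of_le ?_ (norm_le_pi_norm _ ⟨0, hN⟩)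
    rw [Int.norm_eq_abs]
    push_cast
    exact (lt_add_one _).trans_le (le_abs_self _)
  obtain ⟨φ, hφ, B, hB⟩ := hA _ hh
  exact ⟨B, _, hh.comp_strictMono hφ, hB⟩

lemma IsBandDominated.exists_pEssNorm_le {A : Op p N X} (hN : 0 < N) (hA : IsBandDominated A)
    (hrich : IsRich A) : ∃ B ∈ operatorSpectrum A, pEssNorm A ≤ ‖B‖ := by
  rcases le_or_gt (pEssNorm A) 0 with hμ | hμ
  · obtain ⟨B, hB⟩ := hrich.operatorSpectrum_nonempty hN
    exact ⟨B, hB, hμ.trans (norm_nonneg _)⟩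
  set μ := pEssNorm A
  let η : ℕ → ℝ := fun k => 1 / ((k : ℝ) + 1)
  have hη : Tendsto η atTop (𝓝 0) := tendsto_one_div_add_atTop_nhds_zero_nat
  have hηpos : ∀ k, 0 < η k - η (k + 1) := fun k =>
    sub_pos.2 (one_div_lt_one_div_of_lt (by positivity) (by push_cast; linarith))
  choose D hD using fun k => hA.localization (hηpos k)
  -- Strictly below `μ`, yet nonnegative because `η n ≤ 1`, so it can serve as an operator norm
  -- bound.
  let r : ℕ → ℝ := fun n => μ - μ * η n
  have hr : Tendsto r atTop (𝓝 μ) := by simpa using (hη.const_mul μ).const_sub μ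
  have hx : ∀ n : ℕ, ∃ x : LpSeq p N X,
      r n * ‖cut (Metric.closedBall (0 : Fin N → ℤ) n)ᶜ x‖ <
        ‖A (cut (Metric.closedBall (0 : Fin N → ℤ) n)ᶜ x)‖ := by
    intro n
    by_contra! hcon
    have hη1 : η n ≤ 1 := (div_le_one (by positivity)).2 (by linarith [n.cast_nonneg (α := ℝ)])
    have hη0 : 0 < η n := by positivity
    have hrn : 0 ≤ r n := by
      have : r n = μ * (1 - η n) := by simp only [r]; ring
      rw [this]
      exact mul_nonneg hμ.le (by linarith)
    have h1 : ‖A ∘L cut (Metric.closedBall (0 : Fin N → ℤ) n)ᶜ‖ ≤ r n :=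
      ContinuousLinearMap.opNorm_le_bound _ hrn fun x =>
        (hcon x).trans (by gcongr; exact norm_cut_apply_le _ _)
    have h2 : r n < μ := sub_lt_self _ (by positivity)
    exact absurd (hA.pEssNorm_le n) (not_le.2 (h1.trans_lt h2))
  choose x hx using hx
  choose c hc hck using fun n => exists_nested_localization hD n _ (r n) (hx n)
  have hcinf : TendsToInfinity c := TendsToInfinity.of_lt fun n => by
    by_contra! hcon
    exact hc n (cut_apply_of_notMem _ fun h => h (mem_closedBall_zero_iff.2 hcon))
  obtain ⟨φ, hφ, B, hB⟩ := hrich c hcinf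
  refine ⟨B, ⟨_, hcinf.comp_strictMono hφ, hB⟩, ?_⟩
  -- The radius `2 * D k` does not depend on `n`, so the same `B` serves every `k`; the `0` is the
  -- limit of `η (φ n)`.
  have hk : ∀ k, μ - η k + 0 ≤ ‖B‖ := fun k => by
    refine le_norm_limitOp hB (2 * D k)
      (((hr.sub_const (η k)).add hη).comp hφ.tendsto_atTop) ?_
    filter_upwards [hφ.tendsto_atTop.eventually (eventually_gt_atTop k)] with n hn
    exact hck (φ n) k hn
  have h1 : Tendsto (fun k => μ - η k + 0) atTop (𝓝 μ) := by simpa using hη.const_sub μ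
  exact le_of_tendsto' h1 hk

end EssentialNorm

end

end LimitOps

theorem theorem3p2 (p : ENNReal) [Fact (p = 0 ∨ 1 ≤ p)] (N : ℕ) (hN : 0 < N)
    (X : Type*) [NormedAddCommGroup X] [NormedSpace ℂ X] [CompleteSpace X]
    (A : LimitOps.Op p N X)
    (hband : LimitOps.IsBandDominated A) (hrich : LimitOps.IsRich A) :
    IsGreatest {r : ℝ | ∃ B ∈ LimitOps.operatorSpectrum A, r = ‖B‖} (LimitOps.pEssNorm A) := by
  refine ⟨?_, ?_⟩
  · obtain ⟨B, hB, h⟩ := hband.exists_pEssNorm_le hN hrich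
    exact ⟨B, hB, le_antisymm h (LimitOps.norm_limitOp_le_pEssNorm hB)⟩
  · rintro _ ⟨B, hB, rfl⟩
    exact LimitOps.norm_limitOp_le_pEssNorm hB
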